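/- Let $k$ be a field of characteristic zero and let $B=k[U,V,W]$ with the standard grading $\deg U=\deg V=\deg W=1$. A system of variables of $B$ is a triple $\{X,Y,Z\}$ with $k[X,Y,Z]=B$; it is linear if $X,Y,Z$ are linear forms in $U,V,W$. For a $k$-derivation $D$ of $B$: $D$ is locally nilpotent if every $b\in B$ satisfies $D^n(b)=0$ for some $n$; it is irreducible if its image is contained in no proper principal ideal of $B$; it is homogeneous of degree $d$ if it maps homogeneous polynomials of degree $i$ to homogeneous polynomials of degree $i+d$; its rank is the least $r$ such that some system of variables $\{X_1,X_2,X_3\}$ satisfies $DX_j=0$ for all $j>r$; it is triangularizable if there is a system of variables $\{X_1,X_2,X_3\}$ with $DX_1\in k$, $DX_2\in k[X_1]$, $DX_3\in k[X_1,X_2]$. For $D$ locally nilpotent put $\deg_D(0)=-\infty$ and $\deg_D(b)=\max\{n : D^n(b)\neq 0\}$ for $b\ne0$. For $F,G\in B$ let $\Delta_{(F,G)}$ be the derivation $H\mapsto\det\frac{\partial(F,G,H)}{\partial(U,V,W)}$. Let $D$ be an irreducible homogeneous locally nilpotent derivation of $B$ of rank $2$ and degree $d\ge 0$. Then $D$ is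 triangularizable if and only if there exist a linear system of variables $\{X,Y,Z\}$ of $B$, constants $\gamma,\beta\in k^{*}$ and a homogeneous polynomial $f_{d+1}$ of degree $d+1$ in two variables over $k$ (possibly zero) such that $$D=\gamma\,\Delta_{(X,P)},\qquad P=Y^{d+2}+Xf_{d+1}(X,Y)+\beta X^{d+1}Z,$$ and $0=\deg_D(X)<\deg_D(Y)<\deg_D(Z)$. Moreover, whenever $D=\gamma\,\Delta_{(X,P)}$ for such $X,Y,Z,\gamma,\beta,f_{d+1}$ and $P$, one has $\deg_D(X)=0$, $\deg_D(Y)=1$ and $\deg_D(Z)=d+2$. -/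

import Mathlib

namespace HomLND

open MvPolynomial

/-- A derivation is locally nilpotent if every element is killed by some iterate of it. -/
def IsLocallyNilpotent {k A : Type*} [CommRing k] [CommRing A] [Algebra k A]
    (D : Derivation k A A) : Prop :=
  ∀ a : A, ∃ n : ℕ, (⇑D)^[n] a = 0

/-- A derivation is irreducible if its image lies in no proper principal ideal. -/
def IsIrreducible {k A : Type*} [CommRing k] [CommRing A] [Algebra k A]
    (D : Derivation k A A) : Prop :=
  ∀ b : A, (∀ a : A, b ∣ D a) → IsUnit b

/-- The degree function of a locally nilpotent derivation: `deg_D 0 = -∞`, and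
`deg_D b = max {n | D ^ n b ≠ 0}` for `b ≠ 0`. -/
noncomputable def degD {k A : Type*} [CommRing k] [CommRing A] [Algebra k A]
    (D : Derivation k A A) (b : A) : WithBot ℕ :=
  open Classical in
  if b = 0 then ⊥ else ((sSup {n : ℕ | (⇑D)^[n] b ≠ 0} : ℕ) : WithBot ℕ)

/-- A system of variables of `k[x_1, …, x_n]`: the substitution `x_i ↦ s_i` is an automorphism. -/
def IsSystemOfVariables {k : Type*} [Field k] {n : ℕ}
    (s : Fin n → MvPolynomial (Fin n) k) : Prop :=
  Function.Bijective (aeval s : MvPolynomial (Fin n) k →ₐ[k] MvPolynomial (Fin n) k)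

/-- A linear system of variables: a system of variables consisting of linear forms. -/
def IsLinearSystemOfVariables {k : Type*} [Field k] {n : ℕ}
    (s : Fin n → MvPolynomial (Fin n) k) : Prop :=
  IsSystemOfVariables s ∧ ∀ i, (s i).IsHomogeneous 1

/-- `D` is homogeneous of degree `d` for the standard grading. -/
def IsHomogeneousOfDegree {k : Type*} [Field k] {n : ℕ}
    (D : Derivation k (MvPolynomial (Fin n) k) (MvPolynomial (Fin n) k)) (d : ℕ) : Prop :=
  ∀ (i : ℕ) (b : MvPolynomial (Fin n) k), b.IsHomogeneous i → (D b).IsHomogeneous (i + d)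

/-- The rank of `D`: the least `r` for which there is a system of variables of which all but the
first `r` members lie in the kernel of `D`. -/
noncomputable def rank {k : Type*} [Field k] {n : ℕ}
    (D : Derivation k (MvPolynomial (Fin n) k) (MvPolynomial (Fin n) k)) : ℕ :=
  sInf {r : ℕ | ∃ s : Fin n → MvPolynomial (Fin n) k,
    IsSystemOfVariables s ∧ ∀ i : Fin n, r ≤ (i : ℕ) → D (s i) = 0}

/-- `D` is triangularizable: for some system of variables `s_1, …, s_n`, each `D s_i` lies in
`k[s_1, …, s_{i-1}]`. -/
def IsTriangularizable {k : Type*} [Field k] {n : ℕ}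
    (D : Derivation k (MvPolynomial (Fin n) k) (MvPolynomial (Fin n) k)) : Prop :=
  ∃ s : Fin n → MvPolynomial (Fin n) k, IsSystemOfVariables s ∧
    ∀ i : Fin n, D (s i) ∈ Algebra.adjoin k (s '' {j | j < i})

/-- The Jacobian derivation `Δ_(F,G)`, sending `H` to the determinant of the Jacobian matrix of
`(F, G, H)` with respect to the three given variables of the polynomial ring. -/
noncomputable def jacobianDerivation {k : Type*} [Field k] (F G : MvPolynomial (Fin 3) k) :
    Derivation k (MvPolynomial (Fin 3) k) (MvPolynomial (Fin 3) k) :=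
  Derivation.mk'
    { toFun := fun H =>
        Matrix.det (Matrix.of fun i j : Fin 3 => pderiv j ((![F, G, H] : Fin 3 → _) i))
      map_add' := by
        intro a b
        simp [Matrix.det_fin_three]
        ring
      map_smul' := by
        intro c a
        simp [Matrix.det_fin_three, MvPolynomial.smul_eq_C_mul]
        ring }
    (by
      intro a b
      simp [Matrix.det_fin_three]
      ring)

/-- The polynomial `Y ^ (d + 2) + X f(X, Y) + β X ^ (d + 1) Z`. -/
noncomputable def normalFormPoly {k : Type*} [Field k] (d : ℕ) (f : MvPolynomial (Fin 2) k) (β : k)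
    (X Y Z : MvPolynomial (Fin 3) k) : MvPolynomial (Fin 3) k :=
  Y ^ (d + 2) + X * aeval ![X, Y] f + C β * X ^ (d + 1) * Z

/-- With respect to the linear system of variables `X, Y, Z`, the derivation `D` is
`γ Δ_(X, P)` with `P = Y ^ (d + 2) + X f(X, Y) + β X ^ (d + 1) Z`, where `f` is homogeneous of
degree `d + 1` and `γ`, `β` are nonzero constants. -/
def HasNormalForm {k : Type*} [Field k]
    (D : Derivation k (MvPolynomial (Fin 3) k) (MvPolynomial (Fin 3) k)) (d : ℕ)
    (X Y Z : MvPolynomial (Fin 3) k) : Prop :=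
  IsLinearSystemOfVariables ![X, Y, Z] ∧
    ∃ (γ β : k) (f : MvPolynomial (Fin 2) k), γ ≠ 0 ∧ β ≠ 0 ∧ f.IsHomogeneous (d + 1) ∧
      D = γ • jacobianDerivation X (normalFormPoly d f β X Y Z)

end HomLND

/-! The main point is that a homogeneous triangularizable derivation is already triangular in a
linear system of variables. Remove the constant terms of a triangular system and pass to linear
parts, which again form a system. Since `D` raises degree by `d`, every `D s_i` has order at least
`d + 1`. If `D s_i = q(s_j : j < i)`, then `q` also has order at least `d + 1`, because substituting
algebraically independent linear parts cannot kill its lowest form. Comparing components of degree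
`d + 1` gives a triangular relation between the linear parts (`IsTriangularizable.exists_linear`).

In a linear triangular system `x, y, z`, homogeneity forces `D x = 0`, `D y = a x ^ (d + 1)`, and `D
z` a binary form of degree `d + 1` in `x, y`. Rank 2 gives `a ≠ 0`; irreducibility prevents `x` from
dividing `D z`, so `y ^ (d + 1)` occurs there. Integrating `D z` with respect to `y` produces `P` up
to scalars (`hasNormalForm_of_triangular`). Conversely, `hasNormalForm_iff` reads triangularity and
the degrees off the values on `x, y, z`. -/

namespace HomLND

open MvPolynomial

/-! ### Order filtration by powers of the ideal of the variables, and lowest forms of compositions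
-/

section LowestComponents

variable {σ k : Type*} [Field k]

lemma mem_pow_succ_idealOfVars_iff (m : ℕ) (p : MvPolynomial σ k) :
    p ∈ idealOfVars σ k ^ (m + 1) ↔
      p ∈ idealOfVars σ k ^ m ∧ homogeneousComponent m p = 0 := by
  simp only [mem_pow_idealOfVars_iff', MvPolynomial.ext_iff, coeff_homogeneousComponent,
    coeff_zero, ite_eq_right_iff]
  constructor
  · intro h
    exact ⟨fun x hx => h x (by omega), fun x hx => h x (by omega)⟩
  · rintro ⟨h₁, h₂⟩ x hx
    rcases Nat.lt_succ_iff_lt_or_eq.1 hx with h | h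
    · exact h₁ x h
    · exact h₂ x h

lemma homogeneousComponent_eq_zero_of_mem_pow {m : ℕ} {p : MvPolynomial σ k}
    (hp : p ∈ idealOfVars σ k ^ (m + 1)) : homogeneousComponent m p = 0 :=
  ((mem_pow_succ_idealOfVars_iff m p).1 hp).2

lemma mem_pow_idealOfVars_of_homogeneousComponent {m : ℕ} {p : MvPolynomial σ k}
    (hp : ∀ i < m, homogeneousComponent i p = 0) : p ∈ idealOfVars σ k ^ m := by
  induction m with
  | zero => simp
  | succ m ih =>
    exact (mem_pow_succ_idealOfVars_iff m p).2
      ⟨ih fun i hi => hp i (by omega), hp m (by omega)⟩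

lemma sub_homogeneousComponent_mem_pow {m : ℕ} {p : MvPolynomial σ k}
    (hp : p ∈ idealOfVars σ k ^ m) :
    p - homogeneousComponent m p ∈ idealOfVars σ k ^ (m + 1) := by
  rw [mem_pow_idealOfVars_iff'] at hp ⊢
  intro x hx
  rw [coeff_sub, coeff_homogeneousComponent]
  split_ifs with h
  · exact sub_self _
  · rw [hp x (by omega), sub_zero]

lemma IsHomogeneous.mem_pow_idealOfVars {m : ℕ} {p : MvPolynomial σ k} (hp : p.IsHomogeneous m) :
    p ∈ idealOfVars σ k ^ m := by
  rw [mem_pow_idealOfVars_iff']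
  intro x hx
  exact hp.coeff_eq_zero hx.ne

lemma mem_idealOfVars_iff {p : MvPolynomial σ k} :
    p ∈ idealOfVars σ k ↔ constantCoeff p = 0 := by
  rw [← pow_one (idealOfVars σ k), mem_pow_idealOfVars_iff']
  constructor
  · intro h
    exact h 0 (by simp)
  · intro h x hx
    have : x = 0 := x.degree_eq_zero_iff.1 (Nat.lt_one_iff.1 hx)
    rw [this]
    exact h

variable {τ : Type*} {s t : τ → MvPolynomial σ k}

lemma aeval_mem_pow_idealOfVars (hs : ∀ i, s i ∈ idealOfVars σ k) {m : ℕ}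
    {q : MvPolynomial τ k} (hq : q ∈ idealOfVars τ k ^ m) :
    aeval s q ∈ idealOfVars σ k ^ m := by
  have h : (idealOfVars τ k).map (aeval s : MvPolynomial τ k →ₐ[k] MvPolynomial σ k) ≤
      idealOfVars σ k := by
    rw [idealOfVars, Ideal.map_span, Ideal.span_le]
    rintro _ ⟨_, ⟨i, rfl⟩, rfl⟩
    simpa using hs i
  have := Ideal.mem_map_of_mem (aeval s : MvPolynomial τ k →ₐ[k] MvPolynomial σ k) hq
  rw [Ideal.map_pow] at this
  exact Ideal.pow_right_mono h m this

lemma aeval_sub_aeval_mem_sq (hst : ∀ i, s i - t i ∈ idealOfVars σ k ^ 2)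
    (q : MvPolynomial τ k) : aeval s q - aeval t q ∈ idealOfVars σ k ^ 2 := by
  induction q using MvPolynomial.induction_on with
  | C a => simp
  | add p q hp hq =>
    have := add_mem hp hq
    simp only [map_add]
    convert this using 1
    ring
  | mul_X p i hp =>
    have := add_mem (Ideal.mul_mem_right (s i) _ hp) (Ideal.mul_mem_left _ (aeval t p) (hst i))
    simp only [map_mul, aeval_X]
    convert this using 1
    ring

/-- For a product, `a(s)b(s) - a(t)b(t) = (a(s) - a(t))b(s) + a(t)(b(s) - b(t))`, and each summand
gains one order. This lets a substitution be replaced by its linear part without changing the lowest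
form. -/
lemma aeval_sub_aeval_mem_pow (hs : ∀ i, s i ∈ idealOfVars σ k)
    (ht : ∀ i, t i ∈ idealOfVars σ k) (hst : ∀ i, s i - t i ∈ idealOfVars σ k ^ 2)
    {m : ℕ} {q : MvPolynomial τ k} (hq : q ∈ idealOfVars τ k ^ m) :
    aeval s q - aeval t q ∈ idealOfVars σ k ^ (m + 1) := by
  induction m generalizing q with
  | zero =>
    exact Ideal.pow_le_pow_right (by norm_num) (aeval_sub_aeval_mem_sq hst q)
  | succ m ih =>
    rw [pow_succ'] at hq
    induction hq using Submodule.mul_induction_on' with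
    | mem_mul_mem a ha b hb =>
      have h₁ := Ideal.mul_mem_mul (aeval_sub_aeval_mem_sq hst a)
        (aeval_mem_pow_idealOfVars hs hb)
      rw [← pow_one (idealOfVars τ k)] at ha
      have h₂ := Ideal.mul_mem_mul (aeval_mem_pow_idealOfVars ht ha) (ih hb)
      rw [← pow_add] at h₁ h₂
      have h := add_mem (Ideal.pow_le_pow_right (by omega : m + 1 + 1 ≤ _) h₁)
        (Ideal.pow_le_pow_right (by omega : m + 1 + 1 ≤ _) h₂)
      simp only [map_mul]
      convert h using 1
      ring
    | add a _ b _ ha hb =>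
      have := add_mem ha hb
      simp only [map_add]
      convert this using 1
      ring

lemma homogeneousComponent_one_mem (p : MvPolynomial σ k) :
    homogeneousComponent 1 p ∈ idealOfVars σ k := by
  have := IsHomogeneous.mem_pow_idealOfVars (homogeneousComponent_isHomogeneous 1 p)
  rwa [pow_one] at this

lemma sub_homogeneousComponent_one_mem {p : MvPolynomial σ k} (hp : p ∈ idealOfVars σ k) :
    p - homogeneousComponent 1 p ∈ idealOfVars σ k ^ 2 := by
  rw [← pow_one (idealOfVars σ k)] at hp
  exact sub_homogeneousComponent_mem_pow hp

/-- The lowest component of a composition is the composition of the lowest components. -/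
lemma homogeneousComponent_aeval_of_mem_pow (hs : ∀ i, s i ∈ idealOfVars σ k) {m : ℕ}
    {q : MvPolynomial τ k} (hq : q ∈ idealOfVars τ k ^ m) :
    homogeneousComponent m (aeval s q) =
      aeval (fun i => homogeneousComponent 1 (s i)) (homogeneousComponent m q) := by
  have ht := fun i => homogeneousComponent_one_mem (s i)
  have h₁ := aeval_sub_aeval_mem_pow hs ht
    (fun i => sub_homogeneousComponent_one_mem (hs i)) hq
  have h₂ := aeval_mem_pow_idealOfVars ht (sub_homogeneousComponent_mem_pow hq)
  have h := homogeneousComponent_eq_zero_of_mem_pow (add_mem h₁ h₂)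
  have hh : (aeval (fun i => homogeneousComponent 1 (s i))
      (homogeneousComponent m q)).IsHomogeneous m := by
    simpa using (homogeneousComponent_isHomogeneous m q).aeval
      (fun i => homogeneousComponent 1 (s i)) (n := 1)
      (fun i => homogeneousComponent_isHomogeneous 1 (s i))
  rw [map_sub, sub_add_sub_cancel, map_sub, homogeneousComponent_eq_self hh, sub_eq_zero] at h
  exact h

/-- A substitution with algebraically independent linear parts preserves order exactly: a nonzero
lowest form of `q` would survive as the lowest form of the composition. -/
lemma mem_pow_of_aeval_mem_pow (hs : ∀ i, s i ∈ idealOfVars σ k)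
    (ht : Function.Injective (aeval (fun i => homogeneousComponent 1 (s i)) :
      MvPolynomial τ k →ₐ[k] MvPolynomial σ k)) {m : ℕ}
    {q : MvPolynomial τ k} (hq : aeval s q ∈ idealOfVars σ k ^ m) :
    q ∈ idealOfVars τ k ^ m := by
  induction m with
  | zero => simp
  | succ m ih =>
    obtain ⟨h₁, h₂⟩ := (mem_pow_succ_idealOfVars_iff m _).1 hq
    refine (mem_pow_succ_idealOfVars_iff m _).2 ⟨ih h₁, ht ?_⟩
    rw [← homogeneousComponent_aeval_of_mem_pow hs (ih h₁), h₂, map_zero]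

lemma homogeneousComponent_aeval_of_isHomogeneous (ht : ∀ i, (t i).IsHomogeneous 1) (m : ℕ)
    (q : MvPolynomial τ k) :
    homogeneousComponent m (aeval t q) = aeval t (homogeneousComponent m q) := by
  have h : ∀ i, (aeval t (homogeneousComponent i q)).IsHomogeneous i := fun i => by
    simpa using (homogeneousComponent_isHomogeneous i q).aeval t (n := 1) ht
  conv_lhs => rw [← sum_homogeneousComponent q]
  rw [map_sum, map_sum, Finset.sum_congr rfl fun i _ => homogeneousComponent_of_mem (h i)]
  rw [Finset.sum_ite_eq]
  split_ifs with hm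
  · rfl
  · rw [homogeneousComponent_eq_zero, map_zero]
    simpa using hm

end LowestComponents

/-! ### Systems of variables and their linear parts -/

section LinearParts

/-- The kernels of the powers of `f` stabilize, say at `n`. Writing a kernel element as `f ^ n y`
puts `y` in the kernel of `f ^ (n + 1)`, hence of `f ^ n`. Thus a generating `n`-tuple of the
polynomial ring is automatically a system of variables. -/
lemma injective_of_surjective_ringHom {R : Type*} [CommRing R] [IsNoetherianRing R] (f : R →+* R)
    (hf : Function.Surjective f) : Function.Injective f := by
  let K : ℕ →o Ideal R :=
    ⟨fun n => RingHom.ker (f ^ n), monotone_nat_of_le_succ fun n x hx => by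
      rw [RingHom.mem_ker] at hx ⊢
      rw [pow_succ', RingHom.mul_def, RingHom.comp_apply, hx, map_zero]⟩
  obtain ⟨n, hn⟩ := monotone_stabilizes_iff_noetherian.2 ‹IsNoetherianRing R› K
  rw [injective_iff_map_eq_zero]
  intro x hx
  have hfn : Function.Surjective (f ^ n) := by
    rw [RingHom.coe_pow]
    exact hf.iterate n
  obtain ⟨y, rfl⟩ := hfn x
  have hy : y ∈ K (n + 1) := by
    change (f ^ (n + 1)) y = 0
    rw [pow_succ', RingHom.mul_def, RingHom.comp_apply, hx]
  rw [← hn (n + 1) n.le_succ] at hy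
  exact hy

variable {k : Type*} [Field k] {n : ℕ} {s : Fin n → MvPolynomial (Fin n) k}

lemma isSystemOfVariables_of_surjective
    (hs : Function.Surjective (aeval s : MvPolynomial (Fin n) k →ₐ[k] MvPolynomial (Fin n) k)) :
    IsSystemOfVariables s :=
  ⟨injective_of_surjective_ringHom
    (aeval s : MvPolynomial (Fin n) k →ₐ[k] MvPolynomial (Fin n) k).toRingHom hs, hs⟩

lemma surjective_aeval_iff_adjoin_eq_top :
    Function.Surjective (aeval s : MvPolynomial (Fin n) k →ₐ[k] MvPolynomial (Fin n) k) ↔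
      Algebra.adjoin k (Set.range s) = ⊤ := by
  rw [Algebra.adjoin_range_eq_range_aeval, AlgHom.range_eq_top]

lemma IsSystemOfVariables.adjoin_eq_top (hs : IsSystemOfVariables s) :
    Algebra.adjoin k (Set.range s) = ⊤ :=
  surjective_aeval_iff_adjoin_eq_top.1 hs.2

lemma isSystemOfVariables_of_adjoin_eq_top (hs : Algebra.adjoin k (Set.range s) = ⊤) :
    IsSystemOfVariables s :=
  isSystemOfVariables_of_surjective (surjective_aeval_iff_adjoin_eq_top.2 hs)

lemma IsSystemOfVariables.comp_equiv (hs : IsSystemOfVariables s) (e : Equiv.Perm (Fin n)) :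
    IsSystemOfVariables (s ∘ e) := by
  apply isSystemOfVariables_of_adjoin_eq_top
  rw [Set.range_comp, e.range_eq_univ, Set.image_univ, hs.adjoin_eq_top]

lemma adjoin_image_le_adjoin_image_sub_C (s : Fin n → MvPolynomial (Fin n) k) (c : Fin n → k)
    (T : Set (Fin n)) :
    Algebra.adjoin k (s '' T) ≤ Algebra.adjoin k ((fun i => s i - C (c i)) '' T) := by
  rw [Algebra.adjoin_le_iff]
  rintro _ ⟨i, hi, rfl⟩
  have h := add_mem (Algebra.subset_adjoin (R := k)
    (Set.mem_image_of_mem (fun i => s i - C (c i)) hi))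
    (Subalgebra.algebraMap_mem (Algebra.adjoin k ((fun i => s i - C (c i)) '' T)) (c i))
  simpa [algebraMap_eq] using h

lemma IsSystemOfVariables.sub_C (hs : IsSystemOfVariables s) (c : Fin n → k) :
    IsSystemOfVariables fun i => s i - C (c i) := by
  apply isSystemOfVariables_of_adjoin_eq_top
  have h := adjoin_image_le_adjoin_image_sub_C s c Set.univ
  rw [Set.image_univ, Set.image_univ, hs.adjoin_eq_top] at h
  exact top_le_iff.1 h

/-- The linear parts of a system of variables without constant terms form a linear system. -/
lemma IsSystemOfVariables.homogeneousComponent_one (hs : IsSystemOfVariables s)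
    (hs₀ : ∀ i, s i ∈ idealOfVars (Fin n) k) :
    IsLinearSystemOfVariables fun i => homogeneousComponent 1 (s i) := by
  refine ⟨isSystemOfVariables_of_adjoin_eq_top ?_,
    fun i => homogeneousComponent_isHomogeneous 1 (s i)⟩
  rw [← top_le_iff, ← adjoin_range_X, Algebra.adjoin_le_iff, Algebra.adjoin_range_eq_range_aeval]
  rintro _ ⟨i, rfl⟩
  -- If `X i = r(s)`, comparing linear terms writes `X i` as the linear part of `r` evaluated at the
  -- linear parts of `s`. This requires `r` to have no constant term.
  obtain ⟨r, hr⟩ := hs.2 (X i)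
  have hr₀ : r ∈ idealOfVars (Fin n) k ^ 1 := by
    rw [pow_one, mem_idealOfVars_iff]
    have h := congrArg constantCoeff hr
    have h₂ := aeval_mem_pow_idealOfVars hs₀
      (show r - C (constantCoeff r) ∈ idealOfVars (Fin n) k ^ 1 by
        rw [pow_one, mem_idealOfVars_iff]; simp)
    rw [pow_one, mem_idealOfVars_iff, map_sub, map_sub, h] at h₂
    simpa [algebraMap_eq] using h₂
  refine ⟨homogeneousComponent 1 r, ?_⟩
  rw [AlgHom.toRingHom_eq_coe, RingHom.coe_coe, ← homogeneousComponent_aeval_of_mem_pow hs₀ hr₀, hr,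
    homogeneousComponent_eq_self (isHomogeneous_X k i)]

end LinearParts

/-! ### Homogeneous derivations and linearization of a triangular system -/

section Derivations

variable {k : Type*} [Field k] {n : ℕ}
  {D : Derivation k (MvPolynomial (Fin n) k) (MvPolynomial (Fin n) k)} {d : ℕ}

lemma IsHomogeneousOfDegree.homogeneousComponent_add (hD : IsHomogeneousOfDegree D d) (j : ℕ)
    (b : MvPolynomial (Fin n) k) :
    homogeneousComponent (j + d) (D b) = D (homogeneousComponent j b) := by
  conv_lhs => rw [← sum_homogeneousComponent b]
  rw [map_sum, map_sum, Finset.sum_congr rfl fun i _ => homogeneousComponent_of_mem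
    (hD i _ (homogeneousComponent_isHomogeneous i b))]
  simp only [add_left_inj]
  rw [Finset.sum_ite_eq]
  split_ifs with hm
  · rfl
  · rw [homogeneousComponent_eq_zero, map_zero]
    simpa using hm

lemma IsHomogeneousOfDegree.apply_mem_pow (hD : IsHomogeneousOfDegree D d)
    (b : MvPolynomial (Fin n) k) : D b ∈ idealOfVars (Fin n) k ^ (d + 1) := by
  refine mem_pow_idealOfVars_of_homogeneousComponent fun i hi => ?_
  rcases (Nat.lt_succ_iff_lt_or_eq.1 hi) with h | rfl
  · conv_lhs => rw [← sum_homogeneousComponent b]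
    rw [map_sum, map_sum]
    refine Finset.sum_eq_zero fun j _ => ?_
    rw [homogeneousComponent_of_mem (hD j _ (homogeneousComponent_isHomogeneous j b)),
      if_neg (by omega)]
  -- The component of degree `d` could only come from the constant term of `b`, which `D` kills.
  · have := hD.homogeneousComponent_add 0 b
    rw [zero_add] at this
    rw [this, homogeneousComponent_zero, ← algebraMap_eq, D.map_algebraMap]

lemma adjoin_image_eq_map_supported (s : Fin n → MvPolynomial (Fin n) k) (T : Set (Fin n)) :
    Algebra.adjoin k (s '' T) = (supported k T).map (aeval s) := by
  rw [supported, AlgHom.map_adjoin, Set.image_image]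
  simp

lemma homogeneousComponent_mem_supported {T : Set (Fin n)} {q : MvPolynomial (Fin n) k}
    (hq : q ∈ supported k T) (m : ℕ) : homogeneousComponent m q ∈ supported k T := by
  rw [mem_supported] at hq ⊢
  refine Set.Subset.trans ?_ hq
  intro i hi
  simp only [Finset.mem_coe, mem_vars_iff_mem_support] at hi ⊢
  obtain ⟨x, hx, hi⟩ := hi
  refine ⟨x, ?_, hi⟩
  rw [mem_support_iff, coeff_homogeneousComponent] at hx
  rw [mem_support_iff]
  exact fun h => hx (by simp [h])

/-- A homogeneous triangularizable derivation is triangular in a linear system of variables. -/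
lemma IsTriangularizable.exists_linear (hT : IsTriangularizable D)
    (hD : IsHomogeneousOfDegree D d) :
    ∃ t : Fin n → MvPolynomial (Fin n) k, IsLinearSystemOfVariables t ∧
      ∀ i : Fin n, D (t i) ∈ Algebra.adjoin k (t '' {j | j < i}) := by
  obtain ⟨s, hs, hDs⟩ := hT
  set s' : Fin n → MvPolynomial (Fin n) k := fun i => s i - C (constantCoeff (s i)) with hs'
  have hsys : IsSystemOfVariables s' := hs.sub_C _
  have hs₀ : ∀ i, s' i ∈ idealOfVars (Fin n) k := fun i => by
    rw [mem_idealOfVars_iff]; simp [hs']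
  have hlin := hsys.homogeneousComponent_one hs₀
  refine ⟨_, hlin, fun i => ?_⟩
  have hDi : D (s' i) ∈ Algebra.adjoin k (s' '' {j | j < i}) := by
    have : D (s' i) = D (s i) := by
      rw [hs', map_sub, ← algebraMap_eq, D.map_algebraMap, sub_zero]
    rw [this]
    exact adjoin_image_le_adjoin_image_sub_C s _ _ (hDs i)
  rw [adjoin_image_eq_map_supported] at hDi ⊢
  obtain ⟨q, hq, hqD⟩ := hDi
  rw [RingHom.coe_coe] at hqD
  -- The polynomial `q` has order at least `d + 1`, so its component of that degree, evaluated at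
  -- the linear parts, is the degree `d + 1` component of `D (s' i)`. By homogeneity this is `D` of
  -- the linear part of `s' i`.
  refine ⟨homogeneousComponent (d + 1) q, homogeneousComponent_mem_supported hq _, ?_⟩
  rw [RingHom.coe_coe, ← homogeneousComponent_aeval_of_mem_pow hs₀
    (mem_pow_of_aeval_mem_pow hs₀ hlin.1.1 (hqD ▸ hD.apply_mem_pow _)), hqD, add_comm d 1,
    hD.homogeneousComponent_add]

end Derivations

/-! ### Derivations in coordinates and the Jacobian of a linear system -/

section Derivations

lemma derivation_aeval {σ k A : Type*} [Fintype σ] [Field k] [CommRing A] [Algebra k A]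
    (E : Derivation k A A) (t : σ → A) (q : MvPolynomial σ k) :
    E (aeval t q) = ∑ i, aeval t (pderiv i q) * E (t i) := by
  classical
  induction q using MvPolynomial.induction_on with
  | C a => simp
  | add p q hp hq => simp only [map_add, hp, hq, add_mul, Finset.sum_add_distrib]
  | mul_X p j hp =>
    simp only [map_mul, aeval_X, Derivation.leibniz, smul_eq_mul, hp, pderiv_X, map_add, add_mul,
      Finset.sum_add_distrib, Finset.mul_sum]
    congr 1
    · simp [Pi.single_apply, Finset.sum_ite_eq]
    · exact Finset.sum_congr rfl fun i _ => by ring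

variable {k : Type*} [Field k] {n : ℕ} {t : Fin n → MvPolynomial (Fin n) k}
  {D E : Derivation k (MvPolynomial (Fin n) k) (MvPolynomial (Fin n) k)}

lemma IsSystemOfVariables.derivation_ext (ht : IsSystemOfVariables t)
    (h : ∀ i, D (t i) = E (t i)) : D = E := by
  ext1 i
  obtain ⟨q, hq⟩ := ht.2 (X i)
  rw [← hq, derivation_aeval, derivation_aeval]
  simp only [h]

lemma IsSystemOfVariables.dvd_apply (ht : IsSystemOfVariables t) {a : MvPolynomial (Fin n) k}
    (h : ∀ i, a ∣ D (t i)) (b : MvPolynomial (Fin n) k) : a ∣ D b := by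
  obtain ⟨q, rfl⟩ := ht.2 b
  rw [derivation_aeval]
  exact Finset.dvd_sum fun i _ => (h i).mul_left _

lemma IsSystemOfVariables.ne_zero (ht : IsSystemOfVariables t) (i : Fin n) : t i ≠ 0 := by
  intro h
  exact X_ne_zero (R := k) i (ht.1 (by rw [aeval_X, h, map_zero]))

lemma IsHomogeneous.eq_sum_C_mul_X {p : MvPolynomial (Fin n) k} (hp : p.IsHomogeneous 1) :
    ∃ a : Fin n → k, p = ∑ j, C (a j) * X j := by
  have h : p ∈ Submodule.span k (Set.range (X : Fin n → MvPolynomial (Fin n) k)) := by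
    rw [← homogeneousSubmodule_one_eq_span_X]
    exact hp
  obtain ⟨a, ha⟩ := (Submodule.mem_span_range_iff_exists_fun k).1 h
  exact ⟨a, by simp only [← ha, smul_eq_C_mul]⟩

/-- The Jacobian determinant of a linear system of variables is a nonzero constant. -/
lemma IsLinearSystemOfVariables.det_pderiv (ht : IsLinearSystemOfVariables t) :
    ∃ c : k, c ≠ 0 ∧ Matrix.det (Matrix.of fun i j => pderiv j (t i)) = C c := by
  choose a ha using fun i => IsHomogeneous.eq_sum_C_mul_X (ht.2 i)
  have hM : (Matrix.of fun i j => pderiv j (t i)) = (Matrix.of a).map C := by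
    ext1 i j
    simp only [Matrix.of_apply, Matrix.map_apply, ha i, map_sum, pderiv_C_mul, pderiv_X,
      Pi.single_apply]
    simp
  refine ⟨(Matrix.of a).det, fun h => ?_, ?_⟩
  -- A vanishing determinant would give a nontrivial linear relation among the `t i`, contradicting
  -- their algebraic independence.
  · obtain ⟨v, hv, hv₀⟩ := Matrix.exists_vecMul_eq_zero_iff.2 h
    refine hv (funext fun i => ?_)
    have h₁ : ∑ i, C (v i) * t i = 0 := by
      simp only [ha, Finset.mul_sum]
      rw [Finset.sum_comm]
      refine Finset.sum_eq_zero fun j _ => ?_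
      have := congrFun hv₀ j
      simp only [Matrix.vecMul, dotProduct, Matrix.of_apply, Pi.zero_apply] at this
      simp only [← mul_assoc, ← C_mul]
      rw [← Finset.sum_mul, ← map_sum, this, C_0, zero_mul]
    have h₂ : (∑ i, C (v i) * X i : MvPolynomial (Fin n) k) = 0 := by
      apply ht.1.1
      simpa [algebraMap_eq] using h₁
    have h₃ := congrArg (coeff (Finsupp.single i 1)) h₂
    simpa [coeff_sum, coeff_C_mul, coeff_X, Finsupp.single_left_inj] using h₃
  · rw [hM, ← RingHom.mapMatrix_apply, ← RingHom.map_det]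

end Derivations

/-! ### Iterates of a derivation and the degree function -/

section LocallyNilpotent

variable {k A : Type*} [Field k] [CommRing A] [Algebra k A] {D : Derivation k A A}

lemma iterate_kernel_mul {a : A} (ha : D a = 0) (n : ℕ) (b : A) :
    (⇑D)^[n] (a * b) = a * (⇑D)^[n] b := by
  induction n generalizing b with
  | zero => rfl
  | succ n ih =>
    rw [Function.iterate_succ_apply, Function.iterate_succ_apply, D.leibniz, ha, smul_zero,
      add_zero, smul_eq_mul, ih]

lemma iterate_derivation_map_zero (n : ℕ) : (⇑D)^[n] 0 = 0 :=
  Function.iterate_fixed (map_zero D) n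

lemma iterate_derivation_add (n : ℕ) (a b : A) :
    (⇑D)^[n] (a + b) = (⇑D)^[n] a + (⇑D)^[n] b := by
  induction n generalizing a b with
  | zero => rfl
  | succ n ih => simp only [Function.iterate_succ_apply, map_add, ih]

/-- The factor `(i + 1) * D y` produced by the power rule lies in the kernel of `D`, so it passes
through the remaining iterates. -/
lemma iterate_succ_pow {y : A} (hy : D (D y) = 0) (n i : ℕ) :
    (⇑D)^[n + 1] (y ^ (i + 1)) = (i + 1) * D y * (⇑D)^[n] (y ^ i) := by
  have h : D ((i + 1) * D y) = 0 := by
    have : D ((i : A) + 1) = 0 := by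
      have := D.map_natCast (i + 1)
      rwa [Nat.cast_succ] at this
    rw [D.leibniz, hy, this, smul_zero, smul_zero, add_zero]
  rw [Function.iterate_succ_apply, D.leibniz_pow, ← iterate_kernel_mul h]
  congr 1
  simp only [Nat.add_sub_cancel, nsmul_eq_mul, smul_eq_mul, Nat.cast_succ]
  ring

lemma iterate_pow_of_lt {y : A} (hy : D (D y) = 0) {n i : ℕ} (h : i < n) :
    (⇑D)^[n] (y ^ i) = 0 := by
  induction i generalizing n with
  | zero =>
    obtain ⟨m, rfl⟩ := Nat.exists_eq_add_one_of_ne_zero h.ne'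
    rw [Function.iterate_succ_apply, pow_zero, D.map_one_eq_zero, iterate_derivation_map_zero]
  | succ i ih =>
    obtain ⟨m, rfl⟩ := Nat.exists_eq_add_one_of_ne_zero (Nat.ne_zero_of_lt h)
    rw [iterate_succ_pow hy, ih (by omega), mul_zero]

lemma iterate_pow_self {y : A} (hy : D (D y) = 0) (n : ℕ) :
    (⇑D)^[n] (y ^ n) = n.factorial * D y ^ n := by
  induction n with
  | zero => simp
  | succ n ih =>
    rw [iterate_succ_pow hy, ih, Nat.factorial_succ]
    push_cast
    ring

lemma iterate_aeval_of_isHomogeneous {x y : A} (hx : D x = 0) (hy : D (D y) = 0) {m n : ℕ}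
    {f : MvPolynomial (Fin 2) k} (hf : f.IsHomogeneous m) (h : m < n) :
    (⇑D)^[n] (aeval ![x, y] f) = 0 := by
  rw [f.as_sum, map_sum]
  have hsum : ∀ (s : Finset (Fin 2 →₀ ℕ)) (g : (Fin 2 →₀ ℕ) → A),
      (∀ e ∈ s, (⇑D)^[n] (g e) = 0) → (⇑D)^[n] (∑ e ∈ s, g e) = 0 := fun s g hg =>
    Finset.sum_induction _ (fun a => (⇑D)^[n] a = 0)
      (fun a b ha hb => by rw [iterate_derivation_add, ha, hb, add_zero])
      (iterate_derivation_map_zero n) hg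
  refine hsum _ _ fun e he => ?_
  have hdeg : e 0 + e 1 = m := by
    rw [hf.degree_eq_sum_deg_support he, ← Finsupp.degree_apply, Finsupp.degree_eq_sum,
      Fin.sum_univ_two]
  have hker : D (algebraMap k A (coeff e f) * x ^ e 0) = 0 := by
    rw [D.leibniz, D.leibniz_pow, hx, D.map_algebraMap]
    simp
  rw [aeval_monomial, Finsupp.prod_fintype _ _ (by simp), Fin.prod_univ_two, ← mul_assoc]
  simp only [Matrix.cons_val_zero, Matrix.cons_val_one]
  rw [iterate_kernel_mul hker, iterate_pow_of_lt hy (by omega), mul_zero]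

lemma degD_eq_of_iterate {b : A} {n : ℕ} (h : (⇑D)^[n] b ≠ 0) (h' : (⇑D)^[n + 1] b = 0) :
    degD D b = n := by
  have hb : b ≠ 0 := by
    rintro rfl
    exact h (iterate_derivation_map_zero n)
  have hset : IsGreatest {m : ℕ | (⇑D)^[m] b ≠ 0} n := by
    refine ⟨h, fun m hm => ?_⟩
    by_contra! hlt
    obtain ⟨r, rfl⟩ := Nat.exists_eq_add_of_lt hlt
    refine hm ?_
    rw [show n + r + 1 = r + (n + 1) by ring, Function.iterate_add_apply, h',
      iterate_derivation_map_zero]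
  rw [degD, if_neg hb, hset.csSup_eq]

end LocallyNilpotent

/-! ### The normal form, its degrees and its triangularity -/

section NormalForm

variable {k : Type*} [Field k] {x y z : MvPolynomial (Fin 3) k}

/-- The chain rule with one `g` serving all `E`, so that it applies to every partial derivative at
once. The value of `g` is irrelevant: in the Jacobian determinant it contributes a multiple of the
row of `x`. -/
lemma exists_derivation_normalFormPoly (d : ℕ) (f : MvPolynomial (Fin 2) k) (β : k)
    (x y z : MvPolynomial (Fin 3) k) :
    ∃ g, ∀ E : Derivation k (MvPolynomial (Fin 3) k) (MvPolynomial (Fin 3) k),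
      E (normalFormPoly d f β x y z) = g * E x +
      ((d + 2 : MvPolynomial (Fin 3) k) * y ^ (d + 1) + x * aeval ![x, y] (pderiv 1 f)) * E y +
      C β * x ^ (d + 1) * E z := by
  refine ⟨aeval ![x, y] f + x * aeval ![x, y] (pderiv 0 f) +
    C β * ((d + 1 : MvPolynomial (Fin 3) k) * x ^ d) * z, fun E => ?_⟩
  have hC : E (C β) = 0 := by rw [← algebraMap_eq, E.map_algebraMap]
  simp only [normalFormPoly, map_add, E.leibniz, E.leibniz_pow, hC, derivation_aeval,
    Fin.sum_univ_two, Matrix.cons_val_zero, Matrix.cons_val_one, smul_eq_mul, nsmul_eq_mul,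
    Nat.add_sub_cancel]
  push_cast
  ring

lemma jacobianDerivation_apply (F G H : MvPolynomial (Fin 3) k) :
    jacobianDerivation F G H =
      Matrix.det (Matrix.of fun i j : Fin 3 => pderiv j ((![F, G, H] : Fin 3 → _) i)) := rfl

lemma jacobianDerivation_self_left (F G : MvPolynomial (Fin 3) k) :
    jacobianDerivation F G F = 0 := by
  rw [jacobianDerivation_apply]
  simp [Matrix.det_fin_three]
  ring

lemma jacobianDerivation_normalFormPoly_second (d : ℕ) (f : MvPolynomial (Fin 2) k) (β : k)
    (x y z : MvPolynomial (Fin 3) k) :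
    jacobianDerivation x (normalFormPoly d f β x y z) y =
      -(jacobianDerivation x y z * (C β * x ^ (d + 1))) := by
  obtain ⟨g, hg⟩ := exists_derivation_normalFormPoly d f β x y z
  simp only [jacobianDerivation_apply, Matrix.det_fin_three, Matrix.of_apply,
    Matrix.cons_val_zero, Matrix.cons_val_one, Matrix.cons_val, hg]
  ring

lemma jacobianDerivation_normalFormPoly_third (d : ℕ) (f : MvPolynomial (Fin 2) k) (β : k)
    (x y z : MvPolynomial (Fin 3) k) :
    jacobianDerivation x (normalFormPoly d f β x y z) z =
      jacobianDerivation x y z *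
        ((d + 2 : MvPolynomial (Fin 3) k) * y ^ (d + 1) + x * aeval ![x, y] (pderiv 1 f)) := by
  obtain ⟨g, hg⟩ := exists_derivation_normalFormPoly d f β x y z
  simp only [jacobianDerivation_apply, Matrix.det_fin_three, Matrix.of_apply,
    Matrix.cons_val_zero, Matrix.cons_val_one, Matrix.cons_val, hg]
  ring

variable {D : Derivation k (MvPolynomial (Fin 3) k) (MvPolynomial (Fin 3) k)} {d : ℕ}

/-- The normal form, read off from the values of the derivation on the variables. -/
lemma hasNormalForm_iff : HasNormalForm D d x y z ↔
    IsLinearSystemOfVariables ![x, y, z] ∧ ∃ (a c : k) (f : MvPolynomial (Fin 2) k),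
      a ≠ 0 ∧ c ≠ 0 ∧ f.IsHomogeneous (d + 1) ∧ D x = 0 ∧ D y = C a * x ^ (d + 1) ∧
      D z = C c *
        ((d + 2 : MvPolynomial (Fin 3) k) * y ^ (d + 1) + x * aeval ![x, y] (pderiv 1 f)) := by
  refine and_congr_right fun hlin => ?_
  obtain ⟨j, hj, hdet⟩ := hlin.det_pderiv
  rw [← jacobianDerivation_apply] at hdet
  constructor
  · rintro ⟨γ, β, f, hγ, hβ, hf, rfl⟩
    refine ⟨-(γ * j * β), γ * j, f, by simp [hγ, hj, hβ], by simp [hγ, hj], hf, ?_, ?_, ?_⟩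
    · rw [Derivation.smul_apply, jacobianDerivation_self_left, smul_zero]
    · rw [Derivation.smul_apply, jacobianDerivation_normalFormPoly_second, hdet, smul_eq_C_mul]
      simp only [C_neg, C_mul]
      ring
    · rw [Derivation.smul_apply, jacobianDerivation_normalFormPoly_third, hdet, smul_eq_C_mul]
      simp only [C_mul]
      ring
  · rintro ⟨a, c, f, ha, hc, hf, hx, hy, hz⟩
    -- These solve `a = -γ j β` and `c = γ j`, where `j` is the Jacobian determinant of `x, y, z`.
    refine ⟨c / j, -(a / c), f, by simp [hc, hj], by simp [ha, hc], hf,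
      hlin.1.derivation_ext fun i => ?_⟩
    fin_cases i
    · simp [jacobianDerivation_self_left, hx]
    · change D y = (c / j) • jacobianDerivation x (normalFormPoly d f _ x y z) y
      rw [jacobianDerivation_normalFormPoly_second, hdet, smul_eq_C_mul, hy, ← neg_mul, ← C_neg,
        ← mul_assoc, ← mul_assoc, ← C_mul, ← C_mul]
      congr 2
      field_simp
    · change D z = (c / j) • jacobianDerivation x (normalFormPoly d f _ x y z) z
      rw [jacobianDerivation_normalFormPoly_third, hdet, smul_eq_C_mul, hz, ← mul_assoc, ← C_mul,
        div_mul_cancel₀ _ hj]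

lemma HasNormalForm.degD_eq [CharZero k] (h : HasNormalForm D d x y z) :
    degD D x = 0 ∧ degD D y = 1 ∧ degD D z = ((d + 2 : ℕ) : WithBot ℕ) := by
  obtain ⟨hlin, a, c, f, ha, hc, hf, hx, hy, hz⟩ := hasNormalForm_iff.1 h
  have hx₀ : x ≠ 0 := hlin.1.ne_zero 0
  have hy₀ : D y ≠ 0 := by
    rw [hy]
    exact mul_ne_zero (by simpa using ha) (pow_ne_zero _ hx₀)
  have hyy : D (D y) = 0 := by
    rw [hy, ← smul_eq_C_mul, D.map_smul, D.leibniz_pow, hx]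
    simp
  have hker : ∀ b : k, D (C b) = 0 := fun b => by rw [← algebraMap_eq, D.map_algebraMap]
  -- After one application, `d + 1` remain. They kill the form `∂f/∂y`, of degree `d` in `x, y`, and
  -- turn `y ^ (d + 1)` into `(d + 1)! (D y) ^ (d + 1)`.
  have htop : (⇑D)^[d + 2] z = C (c * (d + 2) * (d + 1).factorial) * D y ^ (d + 1) := by
    have hC : ((d : MvPolynomial (Fin 3) k) + 2) = C ((d : k) + 2) := by
      rw [C_add, map_natCast, map_ofNat]
    rw [Function.iterate_succ_apply, hz, iterate_kernel_mul (hker c), iterate_derivation_add,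
      iterate_kernel_mul hx, iterate_aeval_of_isHomogeneous hx hyy hf.pderiv (by omega), mul_zero,
      add_zero, hC, iterate_kernel_mul (hker _), iterate_pow_self hyy]
    simp only [C_mul, map_natCast]
    ring
  refine ⟨degD_eq_of_iterate (n := 0) hx₀ hx, degD_eq_of_iterate (n := 1) hy₀ hyy,
    degD_eq_of_iterate ?_ ?_⟩
  · rw [htop]
    refine mul_ne_zero ?_ (pow_ne_zero _ hy₀)
    rw [Ne, C_eq_zero]
    have : (d : k) + 2 ≠ 0 := by exact_mod_cast (d + 1).succ_ne_zero
    exact mul_ne_zero (mul_ne_zero hc this) (Nat.cast_ne_zero.2 (Nat.factorial_ne_zero _))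
  · rw [Function.iterate_succ_apply', htop, D.leibniz, D.leibniz_pow, hyy, hker]
    simp

lemma HasNormalForm.isTriangularizable (h : HasNormalForm D d x y z) : IsTriangularizable D := by
  obtain ⟨hlin, a, c, f, ha, hc, hf, hx, hy, hz⟩ := hasNormalForm_iff.1 h
  refine ⟨![x, y, z], hlin.1, fun i => ?_⟩
  fin_cases i
  · simp [hx]
  · change D y ∈ _
    have hxm : x ∈ Algebra.adjoin k (![x, y, z] '' {j | j < 1}) :=
      Algebra.subset_adjoin ⟨0, by simp, rfl⟩
    rw [hy, ← smul_eq_C_mul]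
    exact Subalgebra.smul_mem _ (pow_mem hxm _) _
  · change D z ∈ _
    have hxm : x ∈ Algebra.adjoin k (![x, y, z] '' {j | j < 2}) :=
      Algebra.subset_adjoin ⟨0, by simp, rfl⟩
    have hym : y ∈ Algebra.adjoin k (![x, y, z] '' {j | j < 2}) :=
      Algebra.subset_adjoin ⟨1, by simp, rfl⟩
    have hfm : aeval ![x, y] (pderiv 1 f) ∈ Algebra.adjoin k (![x, y, z] '' {j | j < 2}) := by
      have : aeval ![x, y] (pderiv 1 f) ∈ Algebra.adjoin k (Set.range ![x, y]) := by
        rw [Algebra.adjoin_range_eq_range_aeval]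
        exact ⟨_, rfl⟩
      refine Algebra.adjoin_le ?_ this
      rintro _ ⟨i, rfl⟩
      fin_cases i
      · exact hxm
      · exact hym
    rw [hz, ← smul_eq_C_mul]
    refine Subalgebra.smul_mem _ (add_mem (mul_mem (add_mem (natCast_mem _ d) ?_) (pow_mem hym _))
      (mul_mem hxm hfm)) _
    exact ofNat_mem _ 2

end NormalForm

/-! ### From a linear triangular system to the normal form -/

section Triangular

variable {k : Type*} [Field k]

/-- A binary form is the sum of a multiple of a power of the second variable and a multiple of the
first variable, which is integrable with respect to the second variable in characteristic zero. -/
lemma IsHomogeneous.exists_integral [CharZero k] {m : ℕ} {g : MvPolynomial (Fin 2) k}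
    (hg : g.IsHomogeneous m) : ∃ (c : k) (f : MvPolynomial (Fin 2) k),
      f.IsHomogeneous m ∧ g = C c * X 1 ^ m + X 0 * pderiv 1 f := by
  rw [g.as_sum]
  refine Finset.sum_induction _ (fun g => ∃ (c : k) (f : MvPolynomial (Fin 2) k),
      f.IsHomogeneous m ∧ g = C c * X 1 ^ m + X 0 * pderiv 1 f) ?_ ?_ ?_
  · rintro _ _ ⟨c, f, hf, rfl⟩ ⟨c', f', hf', rfl⟩
    exact ⟨c + c', f + f', hf.add hf', by simp only [map_add]; ring⟩
  · exact ⟨0, 0, isHomogeneous_zero _ _ _, by simp⟩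
  · intro e he
    have hdeg : e 0 + e 1 = m := by
      rw [hg.degree_eq_sum_deg_support he, ← Finsupp.degree_apply, Finsupp.degree_eq_sum,
        Fin.sum_univ_two]
    have hmon : monomial e (coeff e g) = C (coeff e g) * (X 0 ^ e 0 * X 1 ^ e 1) := by
      rw [monomial_eq, Finsupp.prod_fintype _ _ (by simp), Fin.prod_univ_two]
    rw [hmon]
    rcases hi : e 0 with _ | i
    -- Pure powers of the second variable are not divisible by the first; they supply the constant
    -- `c`.
    · refine ⟨coeff e g, 0, isHomogeneous_zero _ _ _, ?_⟩
      rw [show e 1 = m by omega]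
      simp
    -- Strip one factor of the first variable and integrate in the second; the degree stays `m`.
    · refine ⟨0, C (coeff e g / (e 1 + 1)) * (X 0 ^ i * X 1 ^ (e 1 + 1)), ?_, ?_⟩
      · have := ((isHomogeneous_X_pow (R := k) (0 : Fin 2) i).mul
          (isHomogeneous_X_pow (1 : Fin 2) (e 1 + 1))).C_mul (coeff e g / (e 1 + 1))
        rwa [show i + (e 1 + 1) = m by omega] at this
      · have h₁ : ((e 1 : k) + 1) ≠ 0 := Nat.cast_add_one_ne_zero _
        have h₂ : C (coeff e g) =
            C (coeff e g / (e 1 + 1)) * ((e 1 : MvPolynomial (Fin 2) k) + 1) := by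
          rw [← map_natCast C, ← C_1, ← C_add, ← C_mul, div_mul_cancel₀ _ h₁]
        rw [h₂, pderiv_C_mul]
        simp only [Derivation.leibniz, Derivation.leibniz_pow, pderiv_X_self,
          pderiv_X_of_ne (show (0 : Fin 2) ≠ 1 by decide), Nat.add_sub_cancel, smul_eq_mul,
          nsmul_eq_mul, C_0]
        push_cast
        ring

variable {x y z : MvPolynomial (Fin 3) k}
  {D : Derivation k (MvPolynomial (Fin 3) k) (MvPolynomial (Fin 3) k)} {d : ℕ}

lemma not_isUnit_of_isHomogeneous_one {σ : Type*} {p : MvPolynomial σ k}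
    (hp : p.IsHomogeneous 1) : ¬ IsUnit p := by
  intro h
  have h₁ := h.map (constantCoeff (R := k) (σ := σ))
  rw [constantCoeff_eq, hp.coeff_eq_zero (by simp)] at h₁
  exact not_isUnit_zero h₁

lemma hasNormalForm_of_triangular [CharZero k] (hIrr : IsIrreducible D)
    (hHom : IsHomogeneousOfDegree D d) (hRank : rank D = 2)
    (hlin : IsLinearSystemOfVariables ![x, y, z]) (hx : D x ∈ Algebra.adjoin k ∅)
    (hy : D y ∈ Algebra.adjoin k {x}) (hz : D z ∈ Algebra.adjoin k (Set.range ![x, y])) :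
    HasNormalForm D d x y z := by
  have hx₁ : x.IsHomogeneous 1 := hlin.2 0
  have hy₁ : y.IsHomogeneous 1 := hlin.2 1
  have hz₁ : z.IsHomogeneous 1 := hlin.2 2
  have hDx : D x = 0 := by
    rw [Algebra.adjoin_empty, Algebra.mem_bot] at hx
    obtain ⟨a, ha⟩ := hx
    -- A constant that is homogeneous of positive degree `1 + d` must vanish.
    have h := homogeneousComponent_eq_self (hHom 1 x hx₁)
    rwa [← ha, algebraMap_eq, homogeneousComponent_of_mem (isHomogeneous_C _ a),
      if_neg (by omega), ← algebraMap_eq, ha, eq_comm] at h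
  obtain ⟨a, hDy⟩ : ∃ a, D y = C a * x ^ (d + 1) := by
    rw [Algebra.adjoin_singleton_eq_range_aeval] at hy
    obtain ⟨p, hp⟩ := hy
    have h := homogeneousComponent_eq_self (hHom 1 y hy₁)
    have hpow : ∀ i, (C (p.coeff i) * x ^ i).IsHomogeneous i := fun i => by
      simpa using (hx₁.pow i).C_mul (p.coeff i)
    rw [← hp, AlgHom.toRingHom_eq_coe, RingHom.coe_coe, Polynomial.aeval_eq_sum_range] at h
    simp only [smul_eq_C_mul, map_sum] at h
    rw [Finset.sum_congr rfl fun i _ => homogeneousComponent_of_mem (hpow i),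
      Finset.sum_ite_eq] at h
    rw [← hp, AlgHom.toRingHom_eq_coe, RingHom.coe_coe, Polynomial.aeval_eq_sum_range]
    simp only [smul_eq_C_mul]
    rw [← h, add_comm d 1]
    split_ifs
    · exact ⟨_, rfl⟩
    · exact ⟨0, by simp⟩
  have ha : a ≠ 0 := by
    rintro rfl
    rw [C_0, zero_mul] at hDy
    -- If `a = 0` then `D` kills `x` and `y`. Swapping puts `z` first, as `rank` asks the last
    -- members of the system to lie in the kernel.
    have h : rank D ≤ 1 := Nat.sInf_le
      ⟨![x, y, z] ∘ Equiv.swap 0 2, hlin.1.comp_equiv _, fun i hi => by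
        fin_cases i
        · simp at hi
        · simpa [Equiv.swap_apply_of_ne_of_ne] using hDy
        · simpa using hDx⟩
    omega
  obtain ⟨g, hg, hDz⟩ : ∃ g : MvPolynomial (Fin 2) k, g.IsHomogeneous (d + 1) ∧
      D z = aeval ![x, y] g := by
    rw [Algebra.adjoin_range_eq_range_aeval] at hz
    obtain ⟨g, hg⟩ := hz
    refine ⟨homogeneousComponent (d + 1) g, homogeneousComponent_isHomogeneous _ _, ?_⟩
    rw [← homogeneousComponent_aeval_of_isHomogeneous]
    · rw [AlgHom.toRingHom_eq_coe, RingHom.coe_coe] at hg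
      rw [hg, add_comm d 1, homogeneousComponent_eq_self (hHom 1 z hz₁)]
    · intro i
      fin_cases i
      · exact hx₁
      · exact hy₁
  obtain ⟨c, f, hf, rfl⟩ := IsHomogeneous.exists_integral hg
  have hc : c ≠ 0 := by
    rintro rfl
    -- If `c = 0`, the nonunit `x` divides `D` of every variable, hence the whole image.
    refine not_isUnit_of_isHomogeneous_one hx₁ (hIrr x (hlin.1.dvd_apply fun i => ?_))
    fin_cases i
    · exact hDx ▸ dvd_zero x
    · change x ∣ D y
      rw [hDy, pow_succ']
      exact (dvd_mul_right _ _).mul_left _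
    · change x ∣ D z
      rw [hDz]
      simp
  have hd : (d : k) + 2 ≠ 0 := by exact_mod_cast (d + 1).succ_ne_zero
  -- Differentiating `y ^ (d + 2)` produces the factor `d + 2`; pulling the scalar `b` out of all of
  -- `D z` rescales `f` by `b⁻¹`.
  set b : k := c / (d + 2) with hb
  have hb₀ : b ≠ 0 := div_ne_zero hc hd
  have hC : C c = C b * ((d : MvPolynomial (Fin 3) k) + 2) := by
    rw [← map_natCast C, ← map_ofNat C, ← C_add, ← C_mul, hb, div_mul_cancel₀ _ hd]
  refine hasNormalForm_iff.2 ⟨hlin, a, b, C b⁻¹ * f, ha, hb₀, by simpa using hf.C_mul b⁻¹,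
    hDx, hDy, ?_⟩
  have hbb : (C b * C b⁻¹ : MvPolynomial (Fin 3) k) = 1 := by
    rw [← C_mul, mul_inv_cancel₀ hb₀, C_1]
  rw [hDz, pderiv_C_mul]
  simp only [map_add, map_mul, map_pow, aeval_X, aeval_C, algebraMap_eq, hC,
    Matrix.cons_val_zero, Matrix.cons_val_one]
  linear_combination (-(x * aeval ![x, y] (pderiv 1 f))) * hbb

end Triangular

end HomLND

theorem mainTheorem7 {k : Type*} [Field k] [CharZero k]
    (D : Derivation k (MvPolynomial (Fin 3) k) (MvPolynomial (Fin 3) k)) (d : ℕ)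
    (hLN : HomLND.IsLocallyNilpotent D) (hIrr : HomLND.IsIrreducible D)
    (hHom : HomLND.IsHomogeneousOfDegree D d) (hRank : HomLND.rank D = 2) :
    (HomLND.IsTriangularizable D ↔
      ∃ X Y Z : MvPolynomial (Fin 3) k, HomLND.HasNormalForm D d X Y Z ∧
        HomLND.degD D X = 0 ∧ 0 < HomLND.degD D Y ∧ HomLND.degD D Y < HomLND.degD D Z) ∧
    (∀ X Y Z : MvPolynomial (Fin 3) k, HomLND.HasNormalForm D d X Y Z →
      HomLND.degD D X = 0 ∧ HomLND.degD D Y = 1 ∧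
        HomLND.degD D Z = ((d + 2 : ℕ) : WithBot ℕ)) := by
  refine ⟨⟨fun hT => ?_, fun ⟨_, _, _, h, _⟩ => h.isTriangularizable⟩, fun _ _ _ h => h.degD_eq⟩
  obtain ⟨t, ht, hDt⟩ := hT.exists_linear hHom
  have hvec : t = ![t 0, t 1, t 2] := by
    ext1 i
    fin_cases i <;> rfl
  have h : HomLND.HasNormalForm D d (t 0) (t 1) (t 2) := by
    refine HomLND.hasNormalForm_of_triangular hIrr hHom hRank (hvec ▸ ht) ?_ ?_ ?_
    · refine Algebra.adjoin_mono ?_ (hDt 0)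
      rintro _ ⟨j, hj, rfl⟩
      exact absurd hj (Fin.not_lt_zero j)
    · refine Algebra.adjoin_mono ?_ (hDt 1)
      rintro _ ⟨j, hj, rfl⟩
      fin_cases j <;> simp at hj ⊢
    · refine Algebra.adjoin_mono ?_ (hDt 2)
      rintro _ ⟨j, hj, rfl⟩
      fin_cases j
      · exact ⟨0, rfl⟩
      · exact ⟨1, rfl⟩
      · simp at hj
  obtain ⟨h₀, h₁, h₂⟩ := h.degD_eq
  refine ⟨_, _, _, h, h₀, ?_, ?_⟩
  · rw [h₁]
    exact zero_lt_one
  · rw [h₁, h₂]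
    exact_mod_cast (by omega : 1 < d + 2)
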